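/- All graphs are finite and may have loops and multiple edges. A plane graph is a graph cellularly embedded in the sphere (every region is an open disc; in particular it is connected). A graph is Eulerian if it is connected and has a closed walk traversing every edge exactly once. For an embedded graph $H$ and a set $B$ of its edges, $H|_B$ denotes the subgraph with edge set $B$ whose vertices are the vertices of $H$ incident with an edge in $B$. $G^*$ is the geometric dual of $G$, whose edge set is identified with $E(G)$ in the natural way. For $A\subseteq E(G)$ put $A^c=E(G)\setminus A$. The partial dual $G^A$ is the cellularly embedded graph obtained as follows: regard $G$ as a ribbon graph (a surface with boundary that is a union of vertex discs and edge discs); for each edge $e\in A^c$ delete the edge disc and record the two arcs along which it was attached to vertex discs by two arrows coloured $e$ that follow an orientation of the boundary of the edge disc; take the geometric dual of the resulting ribbon graph, i.e. glue new vertex discs to all its boundary components and discard the interiors of the old vertex discs, keeping the edge discs in $A$ and the arrows (which now lie on the boundaries of the new vertex discs); finally, for each $e\in A^c$, re-attach an edge disc along the two arrows coloured $e$ according to their directions. **Theorem.** Let $G$ be a plane graph and $A\subseteq E(G)$. Then 1. $G^A$ is bipartite if and only if every connected component of $G|_A$ and every connected component of $G^*|_{A^c}$ is Eulerian; 2. $G^A$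 is Eulerian if and only if $G|_A$ and $G^*|_{A^c}$ are both bipartite. -/

import Mathlib

/-! ### Abstract multigraphs -/

namespace Graph

open scoped Graph

/-- A proper 2-colouring of the vertices exists (in particular there are no loops). -/
def Bipartite {α β : Type*} (H : Graph α β) : Prop :=
  ∃ c : α → Bool, ∀ ⦃e x y⦄, H.IsLink e x y → c x ≠ c y

/-- `H` is nonempty and any two of its vertices are joined by a path. -/
def Connected {α β : Type*} (H : Graph α β) : Prop :=
  V(H).Nonempty ∧ ∀ ⦃x y⦄, x ∈ V(H) → y ∈ V(H) → Relation.ReflTransGen H.Adj x y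

/-- `C` is a connected component of `H`: a maximal connected subgraph. -/
def IsComponent {α β : Type*} (C H : Graph α β) : Prop :=
  Maximal (fun K : Graph α β => K ≤ H ∧ K.Connected) C

/-- `H.IsWalk x l y`: there is a walk in `H` from `x` to `y` whose successive edges are `l`. -/
inductive IsWalk {α β : Type*} (H : Graph α β) : α → List β → α → Prop
  | nil {x : α} : x ∈ V(H) → IsWalk H x [] x
  | cons {x y z : α} {e : β} {l : List β} :
      H.IsLink e x y → IsWalk H y l z → IsWalk H x (e :: l) z

/-- `H` is connected and has an Euler circuit: a closed walk traversing every edge exactly once. -/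
def Eulerian {α β : Type*} (H : Graph α β) : Prop :=
  H.Connected ∧ ∃ (x : α) (l : List β), H.IsWalk x l x ∧ l.Nodup ∧ ∀ e ∈ E(H), e ∈ l

/-- The subgraph induced by an edge set `A`: its edges are those of `A`, its vertices are the
vertices incident with an edge of `A`. -/
def edgeInduce {α β : Type*} (H : Graph α β) (A : Set β) : Graph α β :=
  (H.restrict A).induce {x | ∃ e ∈ A, H.Inc e x}

end Graph

/-! ### Ribbon graphs (equivalently, cellularly embedded graphs) -/

/-- A (possibly non-orientable, possibly disconnected) ribbon graph with edge set `E`, described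
by its flags.  Every edge disc meets the vertex discs in two disjoint arcs; the four end points
of these arcs are the *flags* of the edge, and `F` is the set of all flags.  Every flag `f` is an
end point of exactly three boundary arcs, whose other end points are

* `τ₂ f`, along the arc in which the edge disc is glued to a vertex disc;
* `τ₀ f`, along the free side of the edge disc;
* `τ₁ f`, along the free arc of the boundary of the vertex disc, up to the next edge end.

The vertex discs that meet no edge have no flags; they are listed separately by `V₀`.  Up to
homeomorphism a ribbon graph is the same thing as these data. -/
structure RibbonGraph (F E V₀ : Type*) where
  /-- the edge to which a flag belongs -/
  edge : F → E
  /-- the other end of the same side of the edge disc -/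
  τ₀ : F → F
  /-- the other end of the same free arc of the vertex boundary -/
  τ₁ : F → F
  /-- the other end of the same arc of attachment -/
  τ₂ : F → F
  τ₀_invol : ∀ f, τ₀ (τ₀ f) = f
  τ₁_invol : ∀ f, τ₁ (τ₁ f) = f
  τ₂_invol : ∀ f, τ₂ (τ₂ f) = f
  τ₀_τ₂ : ∀ f, τ₀ (τ₂ f) = τ₂ (τ₀ f)
  τ₀_ne : ∀ f, τ₀ f ≠ f
  τ₁_ne : ∀ f, τ₁ f ≠ f
  τ₂_ne : ∀ f, τ₂ f ≠ f
  τ₀_τ₂_ne : ∀ f, τ₀ (τ₂ f) ≠ f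
  edge_surj : Function.Surjective edge
  /-- two flags belong to the same edge iff they are corners of the same edge disc -/
  edge_eq_iff : ∀ f g, edge f = edge g ↔ g = f ∨ g = τ₀ f ∨ g = τ₂ f ∨ g = τ₀ (τ₂ f)

namespace RibbonGraph

variable {F E V₀ : Type*}

theorem edge_τ₀ (G : RibbonGraph F E V₀) (f : F) : G.edge (G.τ₀ f) = G.edge f :=
  ((G.edge_eq_iff _ _).2 (Or.inr (Or.inl rfl))).symm

theorem edge_τ₂ (G : RibbonGraph F E V₀) (f : F) : G.edge (G.τ₂ f) = G.edge f :=
  ((G.edge_eq_iff _ _).2 (Or.inr (Or.inr (Or.inl rfl)))).symm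

/-- Being in the same orbit under the two maps `σ` and `τ`. -/
def orbitSetoid (σ τ : F → F) : Setoid F :=
  Relation.EqvGen.setoid fun f g => g = σ f ∨ g = τ f

/-- The vertices: boundary circles of the vertex discs that meet an edge (these circles are
traced by alternating `τ₁` and `τ₂`), and the isolated vertices. -/
def Vertex (G : RibbonGraph F E V₀) : Type _ :=
  Quotient (orbitSetoid G.τ₁ G.τ₂) ⊕ V₀

/-- The faces: boundary components of the ribbon graph (traced by alternating `τ₁` and `τ₀`, or
the whole boundary of an isolated vertex). -/
def Face (G : RibbonGraph F E V₀) : Type _ :=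
  Quotient (orbitSetoid G.τ₁ G.τ₀) ⊕ V₀

/-- The vertex at which a flag lies. -/
def vertexOf (G : RibbonGraph F E V₀) (f : F) : G.Vertex :=
  Sum.inl (Quotient.mk (orbitSetoid G.τ₁ G.τ₂) f)

theorem vertexOf_τ₂ (G : RibbonGraph F E V₀) (f : F) : G.vertexOf (G.τ₂ f) = G.vertexOf f :=
  congrArg Sum.inl (Quotient.sound (s := orbitSetoid G.τ₁ G.τ₂)
    (Relation.EqvGen.symm _ _ (Relation.EqvGen.rel f (G.τ₂ f) (Or.inr rfl))))

/-- The underlying abstract graph: the ends of the edge `e` are the vertices at the two ends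
`f`, `τ₀ f` of a side of the edge disc of `e`. -/
def toGraph (G : RibbonGraph F E V₀) : Graph G.Vertex E where
  vertexSet := Set.univ
  IsLink e x y := ∃ f, G.edge f = e ∧ G.vertexOf f = x ∧ G.vertexOf (G.τ₀ f) = y
  isLink_symm := by
    intro e _
    refine ⟨?_⟩
    rintro x y ⟨f, he, hx, hy⟩
    exact ⟨G.τ₀ f, (G.edge_τ₀ f).trans he, hy, by rw [G.τ₀_invol]; exact hx⟩
  eq_or_eq_of_isLink_of_isLink := by
    rintro e x y v w ⟨f, he, rfl, rfl⟩ ⟨g, he', rfl, rfl⟩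
    rcases (G.edge_eq_iff f g).1 (he.trans he'.symm) with h | h | h | h
    · exact Or.inl (by rw [h])
    · exact Or.inr (by rw [h, G.τ₀_invol])
    · exact Or.inl (by rw [h, G.vertexOf_τ₂])
    · exact Or.inr (by rw [h, G.τ₀_invol, G.vertexOf_τ₂])
  left_mem_of_isLink := by
    intro _ _ _ _
    trivial

/-- A plane graph: a graph cellularly embedded in the sphere, i.e. a connected ribbon graph such
that the closed surface obtained by capping off its boundary components is a sphere, which for a
closed connected surface means Euler characteristic `v - e + f = 2`. -/
def IsPlane (G : RibbonGraph F E V₀) : Prop :=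
  G.toGraph.Connected ∧
    (Nat.card G.Vertex : ℤ) - (Nat.card E : ℤ) + (Nat.card G.Face : ℤ) = 2

/-- The geometric dual: the new vertex discs fill in the boundary components, the edge discs are
kept, and the sides of the edge discs exchange roles with the arcs of attachment. -/
def dual (G : RibbonGraph F E V₀) : RibbonGraph F E V₀ where
  edge := G.edge
  τ₀ := G.τ₂
  τ₁ := G.τ₁
  τ₂ := G.τ₀
  τ₀_invol := G.τ₂_invol
  τ₁_invol := G.τ₁_invol
  τ₂_invol := G.τ₀_invol
  τ₀_τ₂ f := (G.τ₀_τ₂ f).symm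
  τ₀_ne := G.τ₂_ne
  τ₁_ne := G.τ₁_ne
  τ₂_ne := G.τ₀_ne
  τ₀_τ₂_ne f := by rw [← G.τ₀_τ₂]; exact G.τ₀_τ₂_ne f
  edge_surj := G.edge_surj
  edge_eq_iff f g := by
    rw [G.edge_eq_iff, ← G.τ₀_τ₂]
    tauto

end RibbonGraph

/-- An arrow-marked ribbon graph.  The labels in `marked` are not edges of the ribbon graph: for
such a label the two arcs `{f, τ₂ f}` and `{τ₀ f, τ₂ (τ₀ f)}` on vertex boundaries carry the two
marking arrows of that colour, one arrow running from `f` to `τ₂ f` and the other one from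
`τ₂ (τ₀ f)` to `τ₀ f` (so `τ₀` only records which ends of the two arrows are to be joined when
the edge is put back).  All other labels are genuine ribbon edges. -/
structure ArrowMarkedRibbonGraph (F E V₀ : Type*) where
  /-- the ribbon graph described, i.e. the one with all the marked edges put back -/
  described : RibbonGraph F E V₀
  /-- the colours of the marking arrows -/
  marked : Set E

/-- Replace the edges in `B` by marking arrows. -/
def RibbonGraph.hide {F E V₀ : Type*} (G : RibbonGraph F E V₀) (B : Set E) :
    ArrowMarkedRibbonGraph F E V₀ :=
  ⟨G, B⟩

namespace ArrowMarkedRibbonGraph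

variable {F E V₀ : Type*}

/-- Replace all marking arrows by edges. -/
def restore (M : ArrowMarkedRibbonGraph F E V₀) : RibbonGraph F E V₀ :=
  M.described

open Classical in
/-- Trace the boundary of the ribbon graph (without the marked edges) from a flag `f` away from
the free arc `{f, τ₁ f}`: at a ribbon edge the boundary follows the side of the edge disc, at a
marking arrow it follows the arrow, which lies on the boundary of a vertex disc. -/
noncomputable def boundaryStep (M : ArrowMarkedRibbonGraph F E V₀) (f : F) : F :=
  if M.described.edge f ∈ M.marked then M.described.τ₂ f else M.described.τ₀ f

open Classical in
/-- The remaining involution: at a ribbon edge the arc of attachment, which becomes a side of the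
edge disc in the dual; at a marking arrow the matching of the ends of the two arrows, which is
unchanged by duality. -/
noncomputable def crossStep (M : ArrowMarkedRibbonGraph F E V₀) (f : F) : F :=
  if M.described.edge f ∈ M.marked then M.described.τ₀ f else M.described.τ₂ f

/-- The geometric dual of an arrow-marked ribbon graph: the new vertex discs fill in the boundary
components, the ribbon edges are kept, and the marking arrows, which lie on boundary components,
are carried over to the new vertices. -/
noncomputable def dual (M : ArrowMarkedRibbonGraph F E V₀) : ArrowMarkedRibbonGraph F E V₀ where
  marked := M.marked
  described :=
    { edge := M.described.edge
      τ₀ := M.crossStep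
      τ₁ := M.described.τ₁
      τ₂ := M.boundaryStep
      τ₀_invol := fun f => by
        by_cases h : M.described.edge f ∈ M.marked <;>
          simp [crossStep, h, RibbonGraph.edge_τ₀, RibbonGraph.edge_τ₂,
            M.described.τ₀_invol, M.described.τ₂_invol]
      τ₁_invol := M.described.τ₁_invol
      τ₂_invol := fun f => by
        by_cases h : M.described.edge f ∈ M.marked <;>
          simp [boundaryStep, h, RibbonGraph.edge_τ₀, RibbonGraph.edge_τ₂,
            M.described.τ₀_invol, M.described.τ₂_invol]
      τ₀_τ₂ := fun f => by
        by_cases h : M.described.edge f ∈ M.marked <;>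
          simp [boundaryStep, crossStep, h, RibbonGraph.edge_τ₀, RibbonGraph.edge_τ₂,
            M.described.τ₀_τ₂]
      τ₀_ne := fun f => by
        by_cases h : M.described.edge f ∈ M.marked <;>
          simp [crossStep, h, M.described.τ₀_ne, M.described.τ₂_ne]
      τ₁_ne := M.described.τ₁_ne
      τ₂_ne := fun f => by
        by_cases h : M.described.edge f ∈ M.marked <;>
          simp [boundaryStep, h, M.described.τ₀_ne, M.described.τ₂_ne]
      τ₀_τ₂_ne := fun f => by
        have h2 := M.described.τ₀_τ₂_ne f
        by_cases h : M.described.edge f ∈ M.marked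
        · simpa [boundaryStep, crossStep, h, RibbonGraph.edge_τ₂] using h2
        · simpa [boundaryStep, crossStep, h, RibbonGraph.edge_τ₀, M.described.τ₀_τ₂] using h2
      edge_surj := M.described.edge_surj
      edge_eq_iff := fun f g => by
        rw [M.described.edge_eq_iff]
        by_cases h : M.described.edge f ∈ M.marked
        · simp [boundaryStep, crossStep, h, RibbonGraph.edge_τ₂]
        · simp only [boundaryStep, crossStep, h, RibbonGraph.edge_τ₀, if_false,
            M.described.τ₀_τ₂]
          tauto }

end ArrowMarkedRibbonGraph

/-- The partial dual `G^A`: hide the edges not in `A` by marking arrows, form the geometric dual,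
and put the hidden edges back. -/
noncomputable def RibbonGraph.partialDual {F E V₀ : Type*} (G : RibbonGraph F E V₀) (A : Set E) :
    RibbonGraph F E V₀ :=
  (G.hide Aᶜ).dual.restore

namespace Graph

open scoped Graph

variable {α β : Type*} {H C : Graph α β} {x y z : α} {e : β} {l l' : List β}

/-! ### Cuts modulo two -/

/-! Everything becomes a linear problem over `ZMod 2` for functions on flags; the partial dual fixes
`τ₁` and swaps `τ₀` with `τ₂` on the flags of `A`.

By Euler's theorem, being Eulerian means being connected with all cuts even. Going round a vertex, a
2-colouring of the free arcs that changes exactly at the ends of edges in `A` exists iff the vertex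
has even degree in `A`. Hence `G|_A` has even cuts iff some `τ₁`-invariant `h` satisfies `h ∘ τ₂ = h
+ 1_A` (`exists_coboundary`, `evenCuts_of_flag_function`); for `G*|_{Aᶜ}` use `τ₀` and `1_{Aᶜ}`.
Bipartiteness is also the existence of a flag function, now constant around vertices.

`G^A` is bipartite iff a single `c` solves the `τ₂`-system for `A` and the `τ₀`-system for `Aᶜ` at
once (`partialDual_bipartite_iff`), so both parity conditions follow. `G^A` has even cuts iff some
`τ₁`-invariant `h` changes along `τ₀` on `A` and along `τ₂` off `A`; the sum of a 2-colouring of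
`G|_A` and one of `G*|_{Aᶜ}` is such an `h`.

The other two implications need the sphere: an edge function summing to zero around every face is
the coboundary of a vertex function (`IsPlane.exists_vertex_potential`). A flag function `h` is
corrected by such a potential `c`, and `h + c` has the missing property. The potential exists
because vertex and face coboundaries are orthogonal and Euler's formula makes their dimensions
complementary. -/

theorem zmod_two_add_self (a : ZMod 2) : a + a = 0 := CharTwo.add_self_eq_zero a

open Classical in
/-- The coboundary of a function `c` on the vertices, modulo two: the value at an edge is the sum
of the values of `c` at its two ends. -/
noncomputable def cut (H : Graph α β) (c : α → ZMod 2) (e : β) : ZMod 2 :=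
  if ∃ x y, H.IsLink e x y ∧ c x ≠ c y then 1 else 0

theorem IsLink.cut_eq (h : H.IsLink e x y) (c : α → ZMod 2) : H.cut c e = c x + c y := by
  unfold cut
  split_ifs with h'
  · obtain ⟨u, v, huv, hc⟩ := h'
    have key : ∀ a b : ZMod 2, a ≠ b → 1 = a + b := by decide
    rcases h.eq_and_eq_or_eq_and_eq huv with ⟨rfl, rfl⟩ | ⟨rfl, rfl⟩
    · exact key _ _ hc
    · exact key _ _ hc.symm
  · push Not at h'
    rw [h' x y h, zmod_two_add_self]

theorem cut_eq_zero_of_forall (c : α → ZMod 2) (h : ∀ x y, H.IsLink e x y → c x = c y) :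
    H.cut c e = 0 := by
  unfold cut
  rw [if_neg]
  rintro ⟨x, y, hl, hne⟩
  exact hne (h x y hl)

theorem cut_eq_zero (c : α → ZMod 2) (he : e ∉ E(H)) : H.cut c e = 0 :=
  cut_eq_zero_of_forall c fun _ _ h => (he h.edge_mem).elim

theorem cut_sum {ι : Type*} (s : Finset ι) (c : ι → α → ZMod 2) (e : β) :
    H.cut (fun x => ∑ i ∈ s, c i x) e = ∑ i ∈ s, H.cut (c i) e := by
  by_cases he : e ∈ E(H)
  · obtain ⟨x, y, h⟩ := exists_isLink_of_mem_edgeSet he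
    simp only [h.cut_eq, Finset.sum_add_distrib]
  · simp only [cut_eq_zero _ he, Finset.sum_const_zero]

/-- Every cut has evenly many edges. -/
def EvenCuts [Fintype β] (H : Graph α β) : Prop :=
  ∀ c : α → ZMod 2, ∑ e, H.cut c e = 0

/-! ### Walks -/

theorem IsWalk.left_mem (h : H.IsWalk x l y) : x ∈ V(H) := by
  cases h with
  | nil h => exact h
  | cons h _ => exact h.left_mem

theorem IsWalk.append (h : H.IsWalk x l y) (h' : H.IsWalk y l' z) : H.IsWalk x (l ++ l') z := by
  induction h with
  | nil _ => exact h'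
  | cons hl _ ih => exact .cons hl (ih h')

theorem IsLink.isWalk (h : H.IsLink e x y) : H.IsWalk x [e] y :=
  .cons h (.nil h.right_mem)

/-- Telescoping: each intermediate vertex contributes twice, so only the ends survive modulo two. -/
theorem IsWalk.sum_cut (h : H.IsWalk x l y) (c : α → ZMod 2) :
    (l.map (H.cut c)).sum = c x + c y := by
  induction h with
  | nil _ => simp [zmod_two_add_self]
  | @cons x y z e l hl _ ih =>
    rw [List.map_cons, List.sum_cons, ih, hl.cut_eq]
    generalize c x = p, c y = q, c z = r
    revert p q r
    decide

theorem IsWalk.exists_split (h : H.IsWalk x l y) (he : e ∈ l) :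
    ∃ u v l₁ l₂, l = l₁ ++ e :: l₂ ∧ H.IsWalk x l₁ u ∧ H.IsLink e u v ∧ H.IsWalk v l₂ y := by
  induction h with
  | nil _ => simp at he
  | @cons x y z e' l hl hw ih =>
    rcases List.mem_cons.1 he with rfl | he
    · exact ⟨x, y, [], l, rfl, .nil hl.left_mem, hl, hw⟩
    · obtain ⟨u, v, l₁, l₂, rfl, h₁, h₂, h₃⟩ := ih he
      exact ⟨u, v, e' :: l₁, l₂, rfl, .cons hl h₁, h₂, h₃⟩

/-! ### Euler circuits -/

theorem sum_eq_list_sum [Fintype β] {M : Type*} [AddCommMonoid M] {f : β → M} (hl : l.Nodup)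
    (h : ∀ e, e ∉ l → f e = 0) : ∑ e, f e = (l.map f).sum := by
  classical
  rw [← List.sum_toFinset f hl]
  exact (Finset.sum_subset (Finset.subset_univ _) fun e _ he => h e (by simpa using he)).symm

theorem Eulerian.evenCuts [Fintype β] (h : H.Eulerian) : H.EvenCuts := by
  obtain ⟨-, x, l, hw, hl, hE⟩ := h
  intro c
  rw [sum_eq_list_sum hl fun e he => cut_eq_zero c fun h => he (hE e h), hw.sum_cut,
    zmod_two_add_self]

/-- A trail that is not closed can be extended. -/
theorem EvenCuts.exists_isLink_of_ne [Fintype β] (hH : H.EvenCuts) (hw : H.IsWalk x l y)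
    (hl : l.Nodup) (hxy : x ≠ y) : ∃ e z, e ∉ l ∧ H.IsLink e y z := by
  classical
  by_contra hcon
  push Not at hcon
  -- If the trail used every edge at its end `y`, the cut around `y` would consist of its edges
  -- only, yet a trail from `x ≠ y` to `y` crosses that cut oddly often.
  let c : α → ZMod 2 := Pi.single y 1
  have h0 : ∀ e, e ∉ l → H.cut c e = 0 := by
    intro e he
    refine cut_eq_zero_of_forall c fun u v huv => ?_
    have hu : u ≠ y := fun h => hcon e v he (h ▸ huv)
    have hv : v ≠ y := fun h => hcon e u he (h ▸ huv.symm)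
    simp [c, hu, hv]
  have := hH c
  rw [sum_eq_list_sum hl h0, hw.sum_cut] at this
  simp [c, hxy] at this

/-- A closed trail missing an edge of a connected graph can be rotated and extended. -/
theorem Connected.exists_trail_of_notMem (hc : H.Connected) (hw : H.IsWalk x l x) (hl : l.Nodup)
    (he : e ∈ E(H)) (hel : e ∉ l) :
    ∃ y z l', H.IsWalk y l' z ∧ l'.Nodup ∧ l'.length = l.length + 1 := by
  by_contra hcon
  -- Rotate the closed trail to start at `z` and put the unused edge `f` in front: this would be a
  -- longer trail.
  have hext : ∀ z w f l₁ l₂, l = l₁ ++ l₂ → H.IsWalk x l₁ z → H.IsWalk z l₂ x →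
      H.IsLink f z w → f ∈ l := by
    intro z w f l₁ l₂ hll h₁ h₂ hf
    by_contra hfl
    have hp : (l₂ ++ l₁).Perm l := by rw [hll]; exact List.perm_append_comm
    refine hcon ⟨w, z, f :: (l₂ ++ l₁), .cons hf.symm (h₂.append h₁), ?_, ?_⟩
    · rw [List.nodup_cons]
      exact ⟨fun h => hfl (hp.mem_iff.1 h), hp.nodup_iff.2 hl⟩
    · simp [hp.length_eq]
  have hall : ∀ z, Relation.ReflTransGen H.Adj x z →
      ∃ l₁ l₂, l = l₁ ++ l₂ ∧ H.IsWalk x l₁ z ∧ H.IsWalk z l₂ x := by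
    intro z hz
    induction hz with
    | refl => exact ⟨[], l, rfl, .nil hw.left_mem, hw⟩
    | @tail u w _ huw ih =>
      obtain ⟨l₁, l₂, hll, h₁, h₂⟩ := ih
      obtain ⟨f, hf⟩ := huw
      obtain ⟨a, b, m₁, m₂, hm, hm₁, hab, hm₂⟩ := hw.exists_split (hext u w f l₁ l₂ hll h₁ h₂ hf)
      rcases hf.right_eq_or_eq hab with rfl | rfl
      · exact ⟨m₁, f :: m₂, hm, hm₁, .cons hab hm₂⟩
      · exact ⟨m₁ ++ [f], m₂, by simp [hm], hm₁.append hab.isWalk, hm₂⟩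
  obtain ⟨u, v, huv⟩ := exists_isLink_of_mem_edgeSet he
  obtain ⟨l₁, l₂, hll, h₁, h₂⟩ := hall u (hc.2 hw.left_mem huv.left_mem)
  exact hel (hext u v e l₁ l₂ hll h₁ h₂ huv)

/-- Without an Euler circuit every trail gives rise to one with one more edge, so there would be
trails longer than the number of edges. -/
theorem Connected.eulerian [Fintype β] (hc : H.Connected) (hH : H.EvenCuts) : H.Eulerian := by
  classical
  by_contra hE
  have htrail : ∀ n, ∃ x y l, H.IsWalk x l y ∧ l.Nodup ∧ l.length = n := by
    intro n
    induction n with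
    | zero =>
      obtain ⟨x, hx⟩ := hc.1
      exact ⟨x, x, [], .nil hx, List.nodup_nil, rfl⟩
    | succ n ih =>
      obtain ⟨x, y, l, hw, hl, rfl⟩ := ih
      by_cases hxy : x = y
      · subst hxy
        by_cases hall : ∀ e ∈ E(H), e ∈ l
        · exact (hE ⟨hc, x, l, hw, hl, hall⟩).elim
        · push Not at hall
          obtain ⟨e, he, hel⟩ := hall
          exact hc.exists_trail_of_notMem hw hl he hel
      · obtain ⟨e, z, hel, hez⟩ := hH.exists_isLink_of_ne hw hl hxy
        refine ⟨x, z, l ++ [e], hw.append hez.isWalk, ?_, by simp⟩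
        exact (List.perm_append_singleton e l).nodup_iff.2 (List.nodup_cons.2 ⟨hel, hl⟩)
  obtain ⟨x, y, l, -, hl, hlen⟩ := htrail (Fintype.card β + 1)
  have := hl.length_le_card
  omega

/-- Euler's theorem. -/
theorem eulerian_iff [Fintype β] : H.Eulerian ↔ H.Connected ∧ H.EvenCuts :=
  ⟨fun h => ⟨h.1, h.evenCuts⟩, fun h => h.1.eulerian h.2⟩

/-! ### Components -/

/-- The subgraph induced by the vertices that can be reached from `x`. -/
def componentOf (H : Graph α β) (x : α) : Graph α β :=
  H.induce {y | Relation.ReflTransGen H.Adj x y}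

theorem mem_of_reflTransGen (hx : x ∈ V(H)) (h : Relation.ReflTransGen H.Adj x y) : y ∈ V(H) := by
  cases h with
  | refl => exact hx
  | tail _ h => exact h.right_mem

theorem reflTransGen_adj_symm (h : Relation.ReflTransGen H.Adj x y) :
    Relation.ReflTransGen H.Adj y x :=
  Relation.ReflTransGen.stdSymm.symm _ _ h

theorem isLink_componentOf {u v : α} (hu : u ∈ V(H.componentOf x)) (h : H.IsLink e u v) :
    (H.componentOf x).IsLink e u v :=
  ⟨h, hu, Relation.ReflTransGen.tail hu ⟨e, h⟩⟩

theorem componentOf_le (hx : x ∈ V(H)) : H.componentOf x ≤ H where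
  vertexSet_mono := fun _ hy => mem_of_reflTransGen hx hy
  isLink_mono := fun _ _ _ h => h.1

theorem reflTransGen_componentOf (h : Relation.ReflTransGen H.Adj x y) :
    Relation.ReflTransGen (H.componentOf x).Adj x y := by
  induction h with
  | refl => exact .refl
  | tail h₁ h₂ ih =>
    obtain ⟨e, he⟩ := h₂
    exact ih.tail ⟨e, isLink_componentOf h₁ he⟩

theorem connected_componentOf (H : Graph α β) (x : α) : (H.componentOf x).Connected :=
  ⟨⟨x, .refl⟩, fun _ _ hu hv =>
    (reflTransGen_adj_symm (reflTransGen_componentOf hu)).trans (reflTransGen_componentOf hv)⟩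

theorem Connected.le_componentOf (hC : C.Connected) (hCH : C ≤ H) (hx : x ∈ V(C)) :
    C ≤ H.componentOf x := by
  have hreach : ∀ y ∈ V(C), Relation.ReflTransGen H.Adj x y := fun y hy =>
    Relation.ReflTransGen.mono (r := C.Adj) (fun _ _ ⟨e, h⟩ => ⟨e, hCH.isLink_mono h⟩) _ _
      (hC.2 hx hy)
  exact ⟨hreach, fun e u v h =>
    ⟨hCH.isLink_mono h, hreach u h.left_mem, hreach v h.right_mem⟩⟩

theorem isComponent_componentOf (hx : x ∈ V(H)) : (H.componentOf x).IsComponent H := by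
  refine ⟨⟨componentOf_le hx, connected_componentOf H x⟩, fun K hK hle => ?_⟩
  exact hK.2.le_componentOf hK.1 (hle.vertexSet_mono (Relation.ReflTransGen.refl : _))

theorem IsComponent.eq_componentOf (hC : C.IsComponent H) :
    ∃ x ∈ V(H), C = H.componentOf x := by
  obtain ⟨x, hx⟩ := hC.prop.2.1
  have hxH := hC.prop.1.vertexSet_mono hx
  refine ⟨x, hxH, le_antisymm ?_ ?_⟩
  · exact hC.prop.2.le_componentOf hC.prop.1 hx
  · exact hC.le_of_ge ⟨componentOf_le hxH, connected_componentOf H x⟩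
      (hC.prop.2.le_componentOf hC.prop.1 hx)

theorem EvenCuts.componentOf [Fintype β] (hH : H.EvenCuts) (x : α) :
    (H.componentOf x).EvenCuts := by
  classical
  intro c
  -- Extension by zero is harmless because no edge leaves a component.
  rw [← hH (fun y => if y ∈ V(H.componentOf x) then c y else 0)]
  refine Finset.sum_congr rfl fun e _ => ?_
  by_cases he : e ∈ E(H.componentOf x)
  · obtain ⟨u, v, h⟩ := exists_isLink_of_mem_edgeSet he
    rw [h.cut_eq, IsLink.cut_eq h.1, if_pos h.left_mem, if_pos h.right_mem]
  · rw [cut_eq_zero _ he, cut_eq_zero_of_forall]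
    intro u v h
    rw [if_neg fun hu => he (isLink_componentOf hu h).edge_mem,
      if_neg fun hv => he (isLink_componentOf hv h.symm).edge_mem]

theorem evenCuts_of_componentOf [Finite α] [Fintype β]
    (hH : ∀ x ∈ V(H), (H.componentOf x).EvenCuts) : H.EvenCuts := by
  classical
  have := Fintype.ofFinite α
  intro c
  -- Cuts are additive in `c`, and the cut of a point mass lies inside the component of that point.
  have hc : c = fun y => ∑ x, (Pi.single x (c x) : α → ZMod 2) y := by
    funext y
    simp [Pi.single_apply]
  rw [hc]
  simp only [cut_sum]
  rw [Finset.sum_comm]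
  refine Finset.sum_eq_zero fun x _ => ?_
  by_cases hx : x ∈ V(H)
  · rw [← hH x hx (Pi.single x (c x))]
    refine Finset.sum_congr rfl fun e _ => ?_
    by_cases he : e ∈ E(H.componentOf x)
    · obtain ⟨u, v, h⟩ := exists_isLink_of_mem_edgeSet he
      rw [h.cut_eq, IsLink.cut_eq h.1]
    · rw [cut_eq_zero _ he, cut_eq_zero_of_forall]
      intro u v h
      have hu : u ≠ x := by
        rintro rfl
        exact he (isLink_componentOf (Relation.ReflTransGen.refl : _) h).edge_mem
      have hv : v ≠ x := by
        rintro rfl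
        exact he (isLink_componentOf (Relation.ReflTransGen.refl : _) h.symm).edge_mem
      simp [hu, hv]
  · refine Finset.sum_eq_zero fun e _ => cut_eq_zero_of_forall _ fun u v h => ?_
    have hu : u ≠ x := fun hu => hx (hu ▸ h.left_mem)
    have hv : v ≠ x := fun hv => hx (hv ▸ h.right_mem)
    simp [hu, hv]

theorem forall_component_eulerian_iff [Finite α] [Fintype β] :
    (∀ C : Graph α β, C.IsComponent H → C.Eulerian) ↔ H.EvenCuts := by
  constructor
  · exact fun h => evenCuts_of_componentOf fun x hx => (h _ (isComponent_componentOf hx)).evenCuts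
  · rintro h C hC
    obtain ⟨x, -, rfl⟩ := hC.eq_componentOf
    exact (connected_componentOf H x).eulerian (h.componentOf x)

theorem edgeInduce_isLink {A : Set β} :
    (H.edgeInduce A).IsLink e x y ↔ e ∈ A ∧ H.IsLink e x y := by
  constructor
  · rintro ⟨⟨h₁, h₂⟩, -, -⟩
    exact ⟨h₁, h₂⟩
  · rintro ⟨h₁, h₂⟩
    exact ⟨⟨h₁, h₂⟩, ⟨e, h₁, h₂.inc_left⟩, ⟨e, h₁, h₂.inc_right⟩⟩

end Graph

/-! ### Sums modulo two over the orbits of involutions -/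

section Involutions

variable {F : Type*} [Fintype F] {τ σ : F → F}

theorem sum_comp_of_invol {M : Type*} [AddCommMonoid M] (hσ : ∀ f, σ (σ f) = f) (g : F → M) :
    ∑ f, g (σ f) = ∑ f, g f :=
  Equiv.sum_comp (Function.Involutive.toPerm σ hσ) g

theorem sum_eq_zero_of_invol (hτ : ∀ f, τ (τ f) = f) (hne : ∀ f, τ f ≠ f) {g : F → ZMod 2}
    (hg : ∀ f, g (τ f) = g f) : ∑ f, g f = 0 :=
  Finset.sum_involution (fun f _ => τ f) (fun f _ => by rw [hg, Graph.zmod_two_add_self])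
    (fun f _ _ => hne f) (fun _ _ => Finset.mem_univ _) (fun f _ => hτ f)

/-- A function that takes the value `1` at exactly one point of every orbit. -/
theorem exists_orbit_section (hσ : ∀ f, σ (σ f) = f) (hne : ∀ f, σ f ≠ f) :
    ∃ r : F → ZMod 2, ∀ f, r (σ f) = r f + 1 := by
  classical
  -- An arbitrary linear order selects the smaller flag of each pair.
  let i := Fintype.equivFin F
  refine ⟨fun f => if i f < i (σ f) then 1 else 0, fun f => ?_⟩
  have h : i (σ f) ≠ i f := fun h => hne f (i.injective h)
  simp only [hσ]
  rcases lt_or_gt_of_ne h with h | h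
  · rw [if_pos h, if_neg h.not_gt]; rfl
  · rw [if_neg h.not_gt, if_pos h]; rfl

/-- Summation by parts over the orbits of `σ`. -/
theorem sum_section_mul_coboundary (hσ : ∀ f, σ (σ f) = f) {r h t : F → ZMod 2}
    (hr : ∀ f, r (σ f) = r f + 1) (ht : ∀ f, t (σ f) = t f) :
    ∑ f, r f * (h f + h (σ f)) * t f = ∑ f, h f * t f := by
  have h1 : ∑ f, r f * h (σ f) * t f = ∑ f, (r f + 1) * h f * t f := by
    rw [← sum_comp_of_invol hσ]
    simp only [hσ, hr, ht]
  simp only [mul_add, add_mul, Finset.sum_add_distrib] at h1 ⊢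
  rw [h1, ← add_assoc, Graph.zmod_two_add_self, zero_add]
  simp

/-- Solvability of `h ∘ τ = h`, `h ∘ σ = h + s`. -/
theorem exists_coboundary (hτ : ∀ f, τ (τ f) = f) (hσ : ∀ f, σ (σ f) = f)
    {r s : F → ZMod 2} (hr : ∀ f, r (σ f) = r f + 1) (hs : ∀ f, s (σ f) = s f)
    (h0 : ∀ t : F → ZMod 2, (∀ f, t (τ f) = t f) → (∀ f, t (σ f) = t f) →
      ∑ f, r f * s f * t f = 0) :
    ∃ h : F → ZMod 2, (∀ f, h (τ f) = h f) ∧ ∀ f, h (σ f) = h f + s f := by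
  classical
  -- Putting `h + h ∘ τ` for the unknown makes `τ`-invariance automatic; what remains is whether `s`
  -- lies in the range of `δ`.
  let δ : (F → ZMod 2) →ₗ[ZMod 2] (F → ZMod 2) :=
    { toFun := fun h f => (h f + h (τ f)) + (h (σ f) + h (τ (σ f)))
      map_add' := fun a b => by funext f; simp only [Pi.add_apply]; ring
      map_smul' := fun c a => by
        funext f; simp only [Pi.smul_apply, smul_eq_mul, RingHom.id_apply]; ring }
  by_cases hmem : s ∈ LinearMap.range δ
  · obtain ⟨h, hh⟩ := hmem
    refine ⟨fun f => h f + h (τ f), fun f => by simp only [hτ, add_comm], fun f => ?_⟩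
    rw [← hh]
    change _ = (h f + h (τ f)) + ((h f + h (τ f)) + (h (σ f) + h (τ (σ f))))
    rw [← add_assoc, Graph.zmod_two_add_self, zero_add]
  · exfalso
    obtain ⟨φ, hφ, hle⟩ := Submodule.exists_le_ker_of_notMem hmem
    obtain ⟨w, rfl⟩ := (dotProductEquiv (ZMod 2) F).surjective φ
    -- The functional `w` kills the range of `δ` but not `s`. The transpose of `δ` sends `w` to `u +
    -- u ∘ τ`, so `u` is invariant under both involutions and may serve as the test function `t`,
    -- which forces `w` to kill `s`.
    let u : F → ZMod 2 := fun f => w f + w (σ f)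
    have huσ : ∀ f, u (σ f) = u f := fun f => by simp only [u, hσ]; rw [add_comm]
    have huτ : ∀ f, u (τ f) = u f := by
      intro g
      have hk : ∑ f, w f * δ (Pi.single g 1) f = 0 :=
        LinearMap.mem_ker.1 (hle (LinearMap.mem_range_self δ (Pi.single g 1)))
      have hk' : ∑ f, w f * δ (Pi.single g 1) f =
          ∑ f, (u f + u (τ f)) * (Pi.single g 1 : F → ZMod 2) f := by
        have e1 : ∀ k : F → ZMod 2, ∑ f, w f * k (σ f) = ∑ f, w (σ f) * k f := fun k => by
          rw [← sum_comp_of_invol hσ]; simp only [hσ]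
        have e2 : ∀ k v : F → ZMod 2, ∑ f, v f * k (τ f) = ∑ f, v (τ f) * k f := fun k v => by
          rw [← sum_comp_of_invol hτ]; simp only [hτ]
        have e3 := e1 fun f => (Pi.single g 1 : F → ZMod 2) (τ f)
        have e4 := e2 (Pi.single g 1) fun f => w (σ f)
        simp only [δ, u, LinearMap.coe_mk, AddHom.coe_mk, mul_add, add_mul,
          Finset.sum_add_distrib, e1, e2, e3]
        ring
      rw [hk'] at hk
      simp only [Pi.single_apply, mul_ite, mul_one, mul_zero, Finset.sum_ite_eq',
        Finset.mem_univ, if_true] at hk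
      exact (CharTwo.add_eq_zero.1 hk).symm
    refine hφ ?_
    change ∑ f, w f * s f = 0
    rw [← h0 u huτ huσ, ← sum_section_mul_coboundary hσ hr hs]
    exact Finset.sum_congr rfl fun f _ => by simp only [u]; ring

end Involutions

/-- If the ranges of `φ` and `ψ` are orthogonal and of complementary dimension, then the range
of `φ` is the orthogonal complement of the range of `ψ`. -/
theorem mem_range_of_orthogonal {K U W ι : Type*} [Field K] [Fintype ι] [AddCommGroup U]
    [Module K U] [AddCommGroup W] [Module K W] [FiniteDimensional K U] [FiniteDimensional K W]
    (φ : U →ₗ[K] ι → K) (ψ : W →ₗ[K] ι → K) (horth : ∀ u w, ∑ i, φ u i * ψ w i = 0)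
    (hφ : Module.finrank K (LinearMap.ker φ) ≤ 1) (hψ : Module.finrank K (LinearMap.ker ψ) ≤ 1)
    (hcard : Fintype.card ι + 2 ≤ Module.finrank K U + Module.finrank K W)
    {a : ι → K} (ha : ∀ w, ∑ i, a i * ψ w i = 0) : a ∈ LinearMap.range φ := by
  classical
  let θ : (ι → K) →ₗ[K] Module.Dual K W := ψ.dualMap ∘ₗ (dotProductEquiv K ι).toLinearMap
  have hθ : ∀ b, b ∈ LinearMap.ker θ ↔ ∀ w, ∑ i, b i * ψ w i = 0 := by
    intro b
    rw [LinearMap.mem_ker, LinearMap.ext_iff]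
    exact Iff.rfl
  have hle : LinearMap.range φ ≤ LinearMap.ker θ := by
    rintro _ ⟨u, rfl⟩
    exact (hθ _).2 fun w => horth u w
  have hrθ : LinearMap.range θ = LinearMap.range ψ.dualMap :=
    LinearMap.range_comp_of_range_eq_top _ (LinearEquiv.range _)
  have h1 := LinearMap.finrank_range_add_finrank_ker θ
  have h2 := LinearMap.finrank_range_add_finrank_ker φ
  have h3 := LinearMap.finrank_range_add_finrank_ker ψ
  rw [hrθ, LinearMap.finrank_range_dualMap_eq_finrank_range, Module.finrank_fintype_fun_eq_card]
    at h1
  -- The kernel of `θ` is the orthogonal complement of the range of `ψ`. Its dimension is `|ι| -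
  -- rank ψ ≤ |ι| - dim W + 1 ≤ dim U - 1 ≤ rank φ`.
  have heq : LinearMap.range φ = LinearMap.ker θ :=
    Submodule.eq_of_le_of_finrank_le hle (by omega)
  rw [heq]
  exact (hθ a).2 ha

namespace RibbonGraph

variable {F E V₀ : Type*} (G : RibbonGraph F E V₀)

/-! ### Functions on flags -/

theorem vertexOf_τ₁ (f : F) : G.vertexOf (G.τ₁ f) = G.vertexOf f :=
  congrArg Sum.inl (Quotient.sound (s := orbitSetoid G.τ₁ G.τ₂)
    (Relation.EqvGen.symm _ _ (Relation.EqvGen.rel f (G.τ₁ f) (Or.inl rfl))))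

/-- A function on flags that is constant around vertices is a function on vertices. -/
theorem exists_vertex_lift {X : Type*} [Nonempty X] {c : F → X} (h₁ : ∀ f, c (G.τ₁ f) = c f)
    (h₂ : ∀ f, c (G.τ₂ f) = c f) : ∃ c' : G.Vertex → X, ∀ f, c' (G.vertexOf f) = c f := by
  refine ⟨Sum.elim (Quotient.lift c fun a b hab => ?_) fun _ => Classical.arbitrary X,
    fun f => rfl⟩
  induction hab with
  | rel a b h =>
    rcases h with rfl | rfl
    · exact (h₁ a).symm
    · exact (h₂ a).symm
  | refl => rfl
  | symm _ _ _ ih => exact ih.symm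
  | trans _ _ _ _ _ ih₁ ih₂ => exact ih₁.trans ih₂

instance [Finite F] [Finite V₀] : Finite G.Vertex :=
  inferInstanceAs (Finite (Quotient (orbitSetoid G.τ₁ G.τ₂) ⊕ V₀))

/-- A chosen flag of an edge. -/
noncomputable def flagOf (e : E) : F := Function.surjInv G.edge_surj e

theorem edge_flagOf (e : E) : G.edge (G.flagOf e) = e := Function.surjInv_eq G.edge_surj e

theorem eq_flagOf {X : Type*} {q : F → X} (h₀ : ∀ f, q (G.τ₀ f) = q f)
    (h₂ : ∀ f, q (G.τ₂ f) = q f) (f : F) : q f = q (G.flagOf (G.edge f)) := by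
  rcases (G.edge_eq_iff _ _).1 (G.edge_flagOf (G.edge f)) with h | h | h | h
  · rw [← h]
  · rw [← h₀ (G.flagOf _), ← h]
  · rw [← h₂ (G.flagOf _), ← h]
  · rw [← h₂ (G.flagOf _), ← h₀ (G.τ₂ _), ← h]

theorem sum_flags [Fintype F] [Fintype E] {M : Type*} [AddCommMonoid M] (g : F → M) :
    ∑ f, g f = ∑ e, (g (G.flagOf e) + (g (G.τ₀ (G.flagOf e)) + (g (G.τ₂ (G.flagOf e)) +
      g (G.τ₀ (G.τ₂ (G.flagOf e)))))) := by
  classical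
  rw [← Finset.sum_fiberwise Finset.univ G.edge g]
  refine Finset.sum_congr rfl fun e _ => ?_
  set f := G.flagOf e with hf
  have hfil : Finset.univ.filter (fun i => G.edge i = e) =
      {f, G.τ₀ f, G.τ₂ f, G.τ₀ (G.τ₂ f)} := by
    ext i
    simp only [Finset.mem_filter, Finset.mem_univ, true_and, Finset.mem_insert,
      Finset.mem_singleton]
    rw [← G.edge_eq_iff, hf, edge_flagOf, eq_comm]
  have h02 : G.τ₀ f ≠ G.τ₂ f := fun h => G.τ₀_τ₂_ne f (by rw [← h, G.τ₀_invol])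
  have h002 : G.τ₀ f ≠ G.τ₀ (G.τ₂ f) := fun h => G.τ₂_ne f (by
    rw [← G.τ₀_invol (G.τ₂ f), ← h, G.τ₀_invol])
  rw [hfil, Finset.sum_insert, Finset.sum_insert, Finset.sum_insert, Finset.sum_singleton]
  · simpa using (G.τ₀_ne (G.τ₂ f)).symm
  · simpa using ⟨h02, h002⟩
  · simpa using ⟨(G.τ₀_ne f).symm, (G.τ₂_ne f).symm, (G.τ₀_τ₂_ne f).symm⟩

/-- A sum over edges, with both ends of each edge contributing, as a sum over flags. -/
theorem sum_edges_eq_sum_flags [Fintype F] [Fintype E] {r a t : F → ZMod 2}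
    (hr : ∀ f, r (G.τ₂ f) = r f + 1) (ha₀ : ∀ f, a (G.τ₀ f) = a f) (ha₂ : ∀ f, a (G.τ₂ f) = a f)
    (ht : ∀ f, t (G.τ₂ f) = t f) :
    ∑ e, a (G.flagOf e) * (t (G.flagOf e) + t (G.τ₀ (G.flagOf e))) = ∑ f, r f * a f * t f := by
  rw [G.sum_flags]
  refine Finset.sum_congr rfl fun e _ => ?_
  -- The values of `r` at the two flags of an edge end add up to `1`, so each end is counted once.
  simp only [G.τ₀_τ₂, hr, ha₀, ha₂, ht]
  generalize r (G.flagOf e) = p, r (G.τ₀ (G.flagOf e)) = q, a (G.flagOf e) = x,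
    t (G.flagOf e) = y, t (G.τ₀ (G.flagOf e)) = z
  revert p q x y z
  decide

/-! ### Connectedness -/

/-- Any two flags are joined by a sequence of flags in which neighbours are related by `τ₀`, `τ₁`
or `τ₂`. -/
def FlagConnected : Prop :=
  ∀ p : F → Prop, (∀ f, p f → p (G.τ₀ f)) → (∀ f, p f → p (G.τ₁ f)) → (∀ f, p f → p (G.τ₂ f)) →
    ∀ f g, p f → p g

variable {G}

theorem flagConnected_of_connected (hG : G.toGraph.Connected) : G.FlagConnected := by
  intro p h₀ h₁ h₂ f g hf
  have h₁' : ∀ f, p (G.τ₁ f) = p f := fun f => propext ⟨fun h => G.τ₁_invol f ▸ h₁ _ h, h₁ f⟩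
  have h₂' : ∀ f, p (G.τ₂ f) = p f := fun f => propext ⟨fun h => G.τ₂_invol f ▸ h₂ _ h, h₂ f⟩
  obtain ⟨p', hp'⟩ := G.exists_vertex_lift h₁' h₂'
  have key : ∀ y, Relation.ReflTransGen G.toGraph.Adj (G.vertexOf f) y → p' y := by
    intro y hy
    induction hy with
    | refl => rwa [hp']
    | tail _ h ih =>
      obtain ⟨e, k, -, rfl, rfl⟩ := h
      rw [hp'] at ih ⊢
      exact h₀ _ ih
  rw [← hp']
  exact key _ (hG.2 (Set.mem_univ _) (Set.mem_univ _))

theorem exists_vertexOf_eq [Nonempty F] (hG : G.toGraph.Connected) (x : G.Vertex) :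
    ∃ f, G.vertexOf f = x := by
  obtain ⟨f⟩ := ‹Nonempty F›
  have h := hG.2 (Set.mem_univ (G.vertexOf f)) (Set.mem_univ x)
  cases h with
  | refl => exact ⟨f, rfl⟩
  | tail _ h =>
    obtain ⟨e, k, -, -, h⟩ := h
    exact ⟨_, h⟩

theorem isEmpty_isolated [Nonempty F] (hG : G.toGraph.Connected) : IsEmpty V₀ := by
  refine ⟨fun v => ?_⟩
  obtain ⟨f, hf⟩ := exists_vertexOf_eq hG (Sum.inr v)
  exact Sum.inl_ne_inr hf

theorem FlagConnected.connected [Nonempty F] [IsEmpty V₀] (hG : G.FlagConnected) :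
    G.toGraph.Connected := by
  obtain ⟨f₀⟩ := ‹Nonempty F›
  refine ⟨⟨G.vertexOf f₀, Set.mem_univ _⟩, ?_⟩
  have hsurj : ∀ x : G.Vertex, ∃ f, G.vertexOf f = x := by
    rintro (q | v)
    · induction q using Quotient.inductionOn with | _ f => exact ⟨f, rfl⟩
    · exact isEmptyElim v
  intro x y _ _
  obtain ⟨f, rfl⟩ := hsurj x
  obtain ⟨g, rfl⟩ := hsurj y
  refine hG (fun k => Relation.ReflTransGen G.toGraph.Adj (G.vertexOf f) (G.vertexOf k))
    (fun k hk => hk.tail ⟨G.edge k, k, rfl, rfl, rfl⟩) (fun k hk => ?_) (fun k hk => ?_) f g .refl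
  · rwa [vertexOf_τ₁]
  · rwa [vertexOf_τ₂]

/-- The notion is symmetric in `τ₀` and `τ₂`, which is why connectedness is transferred through
flags. -/
theorem FlagConnected.dual (hG : G.FlagConnected) : G.dual.FlagConnected :=
  fun p h₀ h₁ h₂ => hG p h₂ h₁ h₀

/-! ### Cuts of a plane graph -/

variable (G) in
/-- The coboundary map from functions on vertices to functions on edges. -/
noncomputable def coboundary : (G.Vertex → ZMod 2) →ₗ[ZMod 2] (E → ZMod 2) where
  toFun c e := c (G.vertexOf (G.flagOf e)) + c (G.vertexOf (G.τ₀ (G.flagOf e)))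
  map_add' a b := by funext e; simp only [Pi.add_apply]; ring
  map_smul' k a := by
    funext e; simp only [Pi.smul_apply, smul_eq_mul, RingHom.id_apply]; ring

theorem coboundary_apply_edge (c : G.Vertex → ZMod 2) (f : F) :
    c (G.vertexOf f) + c (G.vertexOf (G.τ₀ f)) = G.coboundary c (G.edge f) := by
  refine G.eq_flagOf (q := fun f => c (G.vertexOf f) + c (G.vertexOf (G.τ₀ f))) (fun f => ?_)
    (fun f => ?_) f
  · simp only [G.τ₀_invol, add_comm]
  · simp only [G.τ₀_τ₂, vertexOf_τ₂]

/-- By connectedness a function with zero coboundary is determined by its value at one vertex. -/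
theorem finrank_ker_coboundary_le [Finite F] [Finite V₀] [Nonempty F]
    (hG : G.toGraph.Connected) :
    Module.finrank (ZMod 2) (LinearMap.ker G.coboundary) ≤ 1 := by
  obtain ⟨f₀⟩ := ‹Nonempty F›
  have : Nonempty F := ⟨f₀⟩
  let ev : LinearMap.ker G.coboundary →ₗ[ZMod 2] ZMod 2 :=
    LinearMap.proj (G.vertexOf f₀) ∘ₗ (LinearMap.ker G.coboundary).subtype
  have hinj : Function.Injective ev := by
    rw [← LinearMap.ker_eq_bot, LinearMap.ker_eq_bot']
    rintro ⟨c, hc⟩ h0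
    have h0 : c (G.vertexOf f₀) = 0 := h0
    have hτ₀ : ∀ f, c (G.vertexOf f) = 0 → c (G.vertexOf (G.τ₀ f)) = 0 := by
      intro f hf
      have h := coboundary_apply_edge c f
      rwa [LinearMap.mem_ker.1 hc, hf, zero_add] at h
    ext x
    obtain ⟨f, rfl⟩ := exists_vertexOf_eq hG x
    refine flagConnected_of_connected hG (fun f => c (G.vertexOf f) = 0) hτ₀ (fun f hf => ?_)
      (fun f hf => ?_) f₀ f h0
    · rwa [vertexOf_τ₁]
    · rwa [vertexOf_τ₂]
  simpa using LinearMap.finrank_le_finrank_of_injective hinj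

/-- The product at an edge expands into one term for each of its four flags. Vertex and face of a
flag are unchanged by `τ₁`, so the terms cancel in pairs. -/
theorem coboundary_orthogonal [Fintype F] [Fintype E] (c : G.Vertex → ZMod 2)
    (φ : G.dual.Vertex → ZMod 2) : ∑ e, G.coboundary c e * G.dual.coboundary φ e = 0 := by
  have h : ∑ e, G.coboundary c e * G.dual.coboundary φ e =
      ∑ f, c (G.vertexOf f) * φ (G.dual.vertexOf f) := by
    rw [G.sum_flags]
    refine Finset.sum_congr rfl fun e _ => ?_
    have h0 : ∀ f, φ (G.dual.vertexOf (G.τ₀ f)) = φ (G.dual.vertexOf f) := fun f =>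
      congrArg φ (G.dual.vertexOf_τ₂ f)
    change (c (G.vertexOf (G.flagOf e)) + c (G.vertexOf (G.τ₀ (G.flagOf e)))) *
      (φ (G.dual.vertexOf (G.flagOf e)) + φ (G.dual.vertexOf (G.τ₂ (G.flagOf e)))) = _
    rw [h0, h0, G.vertexOf_τ₂, G.τ₀_τ₂, G.vertexOf_τ₂]
    ring
  rw [h]
  refine sum_eq_zero_of_invol G.τ₁_invol G.τ₁_ne fun f => ?_
  rw [G.vertexOf_τ₁]
  exact congrArg _ (congrArg φ (G.dual.vertexOf_τ₁ f))

/-- In a plane graph an edge function that sums to zero around every face is a coboundary. -/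
theorem IsPlane.exists_vertex_potential [Fintype F] [Finite V₀] [Nonempty F] (hG : G.IsPlane)
    {r a : F → ZMod 2} (hr : ∀ f, r (G.τ₀ f) = r f + 1)
    (ha₀ : ∀ f, a (G.τ₀ f) = a f) (ha₂ : ∀ f, a (G.τ₂ f) = a f)
    (h0 : ∀ φ : F → ZMod 2, (∀ f, φ (G.τ₁ f) = φ f) → (∀ f, φ (G.τ₀ f) = φ f) →
      ∑ f, r f * a f * φ f = 0) :
    ∃ c : F → ZMod 2, (∀ f, c (G.τ₁ f) = c f) ∧ (∀ f, c (G.τ₂ f) = c f) ∧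
      ∀ f, c f + c (G.τ₀ f) = a f := by
  classical
  have : Finite E := Finite.of_surjective _ G.edge_surj
  have := Fintype.ofFinite E
  have := Fintype.ofFinite G.Vertex
  have := Fintype.ofFinite G.dual.Vertex
  have := isEmpty_isolated hG.1
  -- Faces of `G` are by definition vertices of the dual, so Euler's formula supplies the dimension
  -- count.
  have hcard : (Nat.card G.Vertex : ℤ) - Nat.card E + Nat.card G.dual.Vertex = 2 := hG.2
  simp only [Nat.card_eq_fintype_card] at hcard
  have hmem : (fun e => a (G.flagOf e)) ∈ LinearMap.range G.coboundary := by
    refine mem_range_of_orthogonal G.coboundary G.dual.coboundary coboundary_orthogonal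
      (finrank_ker_coboundary_le hG.1)
      (finrank_ker_coboundary_le (flagConnected_of_connected hG.1).dual.connected) ?_ fun φ => ?_
    · simp only [Module.finrank_fintype_fun_eq_card]
      omega
    · have h1 : ∀ f, φ (G.dual.vertexOf (G.τ₁ f)) = φ (G.dual.vertexOf f) := fun f =>
        congrArg φ (G.dual.vertexOf_τ₁ f)
      have h2 : ∀ f, φ (G.dual.vertexOf (G.τ₀ f)) = φ (G.dual.vertexOf f) := fun f =>
        congrArg φ (G.dual.vertexOf_τ₂ f)
      rw [← h0 (fun f => φ (G.dual.vertexOf f)) h1 h2]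
      exact G.dual.sum_edges_eq_sum_flags (t := fun f => φ (G.dual.vertexOf f)) hr ha₂ ha₀ h2
  obtain ⟨c, hc⟩ := hmem
  refine ⟨fun f => c (G.vertexOf f), fun f => by simp only [vertexOf_τ₁],
    fun f => by simp only [vertexOf_τ₂], fun f => ?_⟩
  rw [coboundary_apply_edge, hc]
  exact (G.eq_flagOf ha₀ ha₂ f).symm

/-! ### Even cuts and bipartiteness in terms of flags -/

variable (G) in
open Classical in
/-- The indicator function of the flags of the edges in `A`. -/
noncomputable def indicator (A : Set E) (f : F) : ZMod 2 := if G.edge f ∈ A then 1 else 0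

theorem indicator_τ₀ (A : Set E) (f : F) : G.indicator A (G.τ₀ f) = G.indicator A f := by
  unfold indicator
  rw [edge_τ₀]

theorem indicator_τ₂ (A : Set E) (f : F) : G.indicator A (G.τ₂ f) = G.indicator A f := by
  unfold indicator
  rw [edge_τ₂]

/-- Here `r` selects one flag from each edge end. Only the edges of `H` matter, so this covers the
whole graph as well as edge-induced subgraphs. -/
theorem evenCuts_iff [Fintype F] [Fintype E] {H : Graph G.Vertex E} {A : Set E}
    (hH : ∀ e x y, H.IsLink e x y ↔ e ∈ A ∧ G.toGraph.IsLink e x y) {r : F → ZMod 2}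
    (hr : ∀ f, r (G.τ₂ f) = r f + 1) :
    H.EvenCuts ↔ ∀ t : F → ZMod 2, (∀ f, t (G.τ₁ f) = t f) → (∀ f, t (G.τ₂ f) = t f) →
      ∑ f, r f * G.indicator A f * t f = 0 := by
  have key : ∀ c : G.Vertex → ZMod 2, ∑ e, H.cut c e =
      ∑ f, r f * G.indicator A f * c (G.vertexOf f) := by
    intro c
    rw [← G.sum_edges_eq_sum_flags (t := fun f => c (G.vertexOf f)) hr (indicator_τ₀ A)
      (indicator_τ₂ A) (fun f => by rw [vertexOf_τ₂])]
    refine Finset.sum_congr rfl fun e _ => ?_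
    by_cases he : e ∈ A
    · have hl : H.IsLink e (G.vertexOf (G.flagOf e)) (G.vertexOf (G.τ₀ (G.flagOf e))) :=
        (hH _ _ _).2 ⟨he, _, G.edge_flagOf e, rfl, rfl⟩
      rw [hl.cut_eq, indicator, edge_flagOf, if_pos he, one_mul]
    · rw [indicator, edge_flagOf, if_neg he, zero_mul]
      exact Graph.cut_eq_zero_of_forall c fun x y h => (he ((hH _ _ _).1 h).1).elim
  constructor
  · intro h t h₁ h₂
    obtain ⟨c, hc⟩ := G.exists_vertex_lift h₁ h₂
    have := h c
    rw [key] at this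
    simpa only [hc] using this
  · intro h c
    rw [key]
    exact h _ (fun f => by rw [vertexOf_τ₁]) (fun f => by rw [vertexOf_τ₂])

theorem bipartite_iff {H : Graph G.Vertex E} {A : Set E}
    (hH : ∀ e x y, H.IsLink e x y ↔ e ∈ A ∧ G.toGraph.IsLink e x y) :
    H.Bipartite ↔ ∃ c : F → ZMod 2, (∀ f, c (G.τ₁ f) = c f) ∧ (∀ f, c (G.τ₂ f) = c f) ∧
      ∀ f, G.edge f ∈ A → c (G.τ₀ f) = c f + 1 := by
  constructor
  · rintro ⟨b, hb⟩
    refine ⟨fun f => if b (G.vertexOf f) then 1 else 0, fun f => by simp only [vertexOf_τ₁],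
      fun f => by simp only [vertexOf_τ₂], fun f hf => ?_⟩
    have := hb ((hH _ _ _).2 ⟨hf, f, rfl, rfl, rfl⟩)
    beta_reduce
    revert this
    generalize b (G.vertexOf f) = p, b (G.vertexOf (G.τ₀ f)) = q
    revert p q
    decide
  · rintro ⟨c, h₁, h₂, h₀⟩
    obtain ⟨c', hc'⟩ := G.exists_vertex_lift h₁ h₂
    refine ⟨fun x => decide (c' x = 1), fun e x y h => ?_⟩
    obtain ⟨he, f, rfl, rfl, rfl⟩ := (hH _ _ _).1 h
    have := h₀ f he
    simp only [hc', this]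
    generalize c f = p
    revert p
    decide

theorem toGraph_isLink_iff (e : E) (x y : G.Vertex) :
    G.toGraph.IsLink e x y ↔ e ∈ Set.univ ∧ G.toGraph.IsLink e x y := by simp

theorem edgeInduce_isLink_iff (A : Set E) (e : E) (x y : G.Vertex) :
    (G.toGraph.edgeInduce A).IsLink e x y ↔ e ∈ A ∧ G.toGraph.IsLink e x y :=
  Graph.edgeInduce_isLink

end RibbonGraph

namespace RibbonGraph

variable {F E V₀ : Type*} {G : RibbonGraph F E V₀} {A : Set E}

/-! ### Partial duals -/

theorem partialDual_τ₂_of_mem {f : F} (h : G.edge f ∈ A) : (G.partialDual A).τ₂ f = G.τ₀ f :=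
  if_neg (not_not_intro h)

theorem partialDual_τ₂_of_notMem {f : F} (h : G.edge f ∉ A) : (G.partialDual A).τ₂ f = G.τ₂ f :=
  if_pos h

theorem partialDual_τ₀_of_mem {f : F} (h : G.edge f ∈ A) : (G.partialDual A).τ₀ f = G.τ₂ f :=
  if_neg (not_not_intro h)

theorem partialDual_τ₀_of_notMem {f : F} (h : G.edge f ∉ A) : (G.partialDual A).τ₀ f = G.τ₀ f :=
  if_pos h

theorem indicator_of_mem {f : F} (h : G.edge f ∈ A) : G.indicator A f = 1 := if_pos h

theorem indicator_of_notMem {f : F} (h : G.edge f ∉ A) : G.indicator A f = 0 := if_neg h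

theorem FlagConnected.partialDual (hG : G.FlagConnected) (A : Set E) :
    (G.partialDual A).FlagConnected := by
  intro p h₀ h₁ h₂
  refine hG p (fun f hf => ?_) h₁ (fun f hf => ?_)
  · by_cases h : G.edge f ∈ A
    · exact partialDual_τ₂_of_mem h ▸ h₂ f hf
    · exact partialDual_τ₀_of_notMem h ▸ h₀ f hf
  · by_cases h : G.edge f ∈ A
    · exact partialDual_τ₀_of_mem h ▸ h₀ f hf
    · exact partialDual_τ₂_of_notMem h ▸ h₂ f hf

theorem partialDual_connected (hG : G.toGraph.Connected) (A : Set E) :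
    (G.partialDual A).toGraph.Connected := by
  rcases isEmpty_or_nonempty F with hF | hF
  · have hsub : ∀ v w : V₀, v = w := by
      intro v w
      have h := hG.2 (Set.mem_univ (Sum.inr v)) (Set.mem_univ (Sum.inr w))
      rcases h.cases_head with h | ⟨_, ⟨_, f, _⟩, _⟩
      · exact Sum.inr_injective h
      · exact hF.elim f
    have hinr : ∀ {H : RibbonGraph F E V₀} (x : H.Vertex), ∃ v : V₀, x = Sum.inr v := by
      rintro H (q | v)
      · obtain ⟨f, -⟩ := Quotient.exists_rep q
        exact hF.elim f
      · exact ⟨v, rfl⟩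
    obtain ⟨x, -⟩ := hG.1
    obtain ⟨v, -⟩ := hinr x
    refine ⟨⟨Sum.inr v, Set.mem_univ _⟩, fun x y _ _ => ?_⟩
    obtain ⟨v, rfl⟩ := hinr x
    obtain ⟨w, rfl⟩ := hinr y
    rw [hsub v w]
    exact .refl
  · have := isEmpty_isolated hG
    exact ((flagConnected_of_connected hG).partialDual A).connected

theorem partialDual_bipartite_iff :
    (G.partialDual A).toGraph.Bipartite ↔ ∃ c : F → ZMod 2, (∀ f, c (G.τ₁ f) = c f) ∧
      (∀ f, c (G.τ₀ f) = c f + G.indicator Aᶜ f) ∧ ∀ f, c (G.τ₂ f) = c f + G.indicator A f := by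
  rw [bipartite_iff toGraph_isLink_iff]
  refine exists_congr fun c => and_congr Iff.rfl ?_
  constructor
  · rintro ⟨h₂, h₀⟩
    refine ⟨fun f => ?_, fun f => ?_⟩
    · by_cases h : G.edge f ∈ A
      · rw [indicator_of_notMem (not_not_intro h), add_zero, ← h₂ f, partialDual_τ₂_of_mem h]
      · rw [indicator_of_mem (A := Aᶜ) h, ← h₀ f trivial, partialDual_τ₀_of_notMem h]
    · by_cases h : G.edge f ∈ A
      · rw [indicator_of_mem h, ← h₀ f trivial, partialDual_τ₀_of_mem h]
      · rw [indicator_of_notMem h, add_zero, ← h₂ f, partialDual_τ₂_of_notMem h]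
  · rintro ⟨h₀, h₂⟩
    refine ⟨fun f => ?_, fun f _ => ?_⟩
    · by_cases h : G.edge f ∈ A
      · rw [partialDual_τ₂_of_mem h, h₀, indicator_of_notMem (not_not_intro h), add_zero]
      · rw [partialDual_τ₂_of_notMem h, h₂, indicator_of_notMem h, add_zero]
    · by_cases h : G.edge f ∈ A
      · rw [partialDual_τ₀_of_mem h, h₂, indicator_of_mem h]
      · rw [partialDual_τ₀_of_notMem h, h₀, indicator_of_mem (A := Aᶜ) h]

/-- A function on flags that is constant along the free arcs and changes along the arcs of
attachment of exactly the edges in `A` certifies that all vertices have even degree in `A`. -/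
theorem evenCuts_of_flag_function [Fintype F] [Fintype E] {H : Graph G.Vertex E}
    (hH : ∀ e x y, H.IsLink e x y ↔ e ∈ A ∧ G.toGraph.IsLink e x y) {c : F → ZMod 2}
    (h₁ : ∀ f, c (G.τ₁ f) = c f) (h₂ : ∀ f, c (G.τ₂ f) = c f + G.indicator A f) :
    H.EvenCuts := by
  obtain ⟨r, hr⟩ := exists_orbit_section G.τ₂_invol G.τ₂_ne
  rw [evenCuts_iff hH hr]
  intro t ht₁ ht₂
  have h : ∀ f, G.indicator A f = c f + c (G.τ₂ f) := fun f => by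
    rw [h₂, ← add_assoc, Graph.zmod_two_add_self, zero_add]
  simp only [h]
  rw [sum_section_mul_coboundary G.τ₂_invol hr ht₂]
  exact sum_eq_zero_of_invol G.τ₁_invol G.τ₁_ne fun f => by rw [h₁, ht₁]

/-- Converse of `evenCuts_of_flag_function`: even cuts are exactly the solvability condition in
`exists_coboundary`. -/
theorem exists_flag_function_of_evenCuts [Fintype F] [Fintype E] {H : Graph G.Vertex E}
    (hH : ∀ e x y, H.IsLink e x y ↔ e ∈ A ∧ G.toGraph.IsLink e x y) (hE : H.EvenCuts) :
    ∃ c : F → ZMod 2, (∀ f, c (G.τ₁ f) = c f) ∧ ∀ f, c (G.τ₂ f) = c f + G.indicator A f := by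
  obtain ⟨r, hr⟩ := exists_orbit_section G.τ₂_invol G.τ₂_ne
  exact exists_coboundary G.τ₁_invol G.τ₂_invol hr (indicator_τ₂ A) ((evenCuts_iff hH hr).1 hE)

theorem IsPlane.partialDual_bipartite [Fintype F] [Fintype E] [Finite V₀] [Nonempty F]
    (hG : G.IsPlane) (hA : (G.toGraph.edgeInduce A).EvenCuts)
    (hA' : (G.dual.toGraph.edgeInduce Aᶜ).EvenCuts) : (G.partialDual A).toGraph.Bipartite := by
  rw [partialDual_bipartite_iff]
  obtain ⟨h, h₁, h₂⟩ := exists_flag_function_of_evenCuts (edgeInduce_isLink_iff A) hA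
  obtain ⟨r, hr⟩ := exists_orbit_section G.τ₀_invol G.τ₀_ne
  have hface := (G.dual.evenCuts_iff (edgeInduce_isLink_iff Aᶜ) hr).1 hA'
  -- The function `a` is the error of `h` in the `τ₀`-equation. Under `τ₂` both values of `h` in it
  -- change by `1_A`, so it is an edge function; it vanishes around faces because `h` is
  -- `τ₁`-invariant and `G*|_{Aᶜ}` has even cuts.
  obtain ⟨c, hc₁, hc₂, hc₀⟩ := hG.exists_vertex_potential (r := r)
    (a := fun f => h f + h (G.τ₀ f) + G.indicator Aᶜ f) hr
    (fun f => by simp only [G.τ₀_invol, indicator_τ₀]; ring)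
    (fun f => by
      simp only [G.τ₀_τ₂, h₂, indicator_τ₂, indicator_τ₀]
      generalize h f = p, h (G.τ₀ f) = q, G.indicator A f = x, G.indicator Aᶜ f = y
      revert p q x y
      decide)
    (fun φ hφ₁ hφ₀ => by
      simp only [mul_add, add_mul, Finset.sum_add_distrib]
      have e1 := sum_section_mul_coboundary (h := h) G.τ₀_invol hr hφ₀
      have e2 : ∑ f, h f * φ f = 0 :=
        sum_eq_zero_of_invol G.τ₁_invol G.τ₁_ne fun f => by rw [h₁, hφ₁]
      have e3 : ∑ f, r f * G.indicator Aᶜ f * φ f = 0 := hface φ hφ₁ hφ₀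
      simp only [mul_add, add_mul, Finset.sum_add_distrib] at e1
      rw [e1, e2, e3, add_zero])
  refine ⟨fun f => h f + c f, fun f => by simp only [h₁, hc₁], fun f => ?_, fun f => ?_⟩
  · have := hc₀ f
    revert this
    beta_reduce
    generalize h f = p, h (G.τ₀ f) = q, c f = x, c (G.τ₀ f) = y, G.indicator Aᶜ f = z
    revert p q x y z
    decide
  · simp only [h₂, hc₂]
    ring

theorem partialDual_evenCuts [Fintype F] [Fintype E] (hA : (G.toGraph.edgeInduce A).Bipartite)
    (hA' : (G.dual.toGraph.edgeInduce Aᶜ).Bipartite) :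
    (G.partialDual A).toGraph.EvenCuts := by
  obtain ⟨c, hc₁, hc₂, hc₀⟩ := (bipartite_iff (edgeInduce_isLink_iff A)).1 hA
  obtain ⟨d, hd₁, hd₀, hd₂⟩ := (bipartite_iff (edgeInduce_isLink_iff Aᶜ)).1 hA'
  have hd₁ : ∀ f, d (G.τ₁ f) = d f := hd₁
  have hd₀ : ∀ f, d (G.τ₀ f) = d f := hd₀
  have hd₂ : ∀ f, G.edge f ∉ A → d (G.τ₂ f) = d f + 1 := hd₂
  -- Along an attaching arc of the partial dual exactly one of the two colourings changes: `c` on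
  -- `A`, `d` off `A`.
  refine evenCuts_of_flag_function toGraph_isLink_iff (c := fun f => c f + d f) (fun f => ?_)
    fun f => ?_
  · exact congrArg₂ _ (hc₁ f) (hd₁ f)
  · rw [indicator_of_mem (Set.mem_univ _)]
    by_cases h : G.edge f ∈ A
    · rw [partialDual_τ₂_of_mem h, hc₀ f h, hd₀]
      ring
    · rw [partialDual_τ₂_of_notMem h, hc₂, hd₂ f h]
      ring

theorem IsPlane.bipartite_of_partialDual_evenCuts [Fintype F] [Fintype E] [Finite V₀] [Nonempty F]
    (hG : G.IsPlane) (hE : (G.partialDual A).toGraph.EvenCuts) :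
    (G.toGraph.edgeInduce A).Bipartite ∧ (G.dual.toGraph.edgeInduce Aᶜ).Bipartite := by
  obtain ⟨h, h₁, hσ⟩ := exists_flag_function_of_evenCuts toGraph_isLink_iff hE
  have h₁ : ∀ f, h (G.τ₁ f) = h f := h₁
  have h₀ : ∀ f, G.edge f ∈ A → h (G.τ₀ f) = h f + 1 := fun f hf => by
    rw [← partialDual_τ₂_of_mem hf, hσ, indicator_of_mem (Set.mem_univ _)]
  have h₂ : ∀ f, G.edge f ∉ A → h (G.τ₂ f) = h f + 1 := fun f hf => by
    rw [← partialDual_τ₂_of_notMem hf, hσ, indicator_of_mem (Set.mem_univ _)]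
  obtain ⟨r, hr⟩ := exists_orbit_section G.τ₀_invol G.τ₀_ne
  -- On `A` the function `h + h ∘ τ₀` is constantly `1`; off `A` both summands change under `τ₂`. So
  -- it is an edge function, and its potential `c` 2-colours `G|_A` while `h + c` 2-colours the
  -- faces.
  obtain ⟨c, hc₁, hc₂, hc₀⟩ := hG.exists_vertex_potential (r := r)
    (a := fun f => h f + h (G.τ₀ f)) hr
    (fun f => by simp only [G.τ₀_invol, add_comm])
    (fun f => by
      by_cases hf : G.edge f ∈ A
      · rw [h₀ f hf, h₀ (G.τ₂ f) (by rwa [edge_τ₂])]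
        generalize h f = p, h (G.τ₂ f) = q
        revert p q
        decide
      · rw [G.τ₀_τ₂, h₂ f hf, h₂ (G.τ₀ f) (by rwa [edge_τ₀])]
        generalize h f = p, h (G.τ₀ f) = q
        revert p q
        decide)
    (fun φ hφ₁ hφ₀ => by
      rw [sum_section_mul_coboundary G.τ₀_invol hr hφ₀]
      exact sum_eq_zero_of_invol G.τ₁_invol G.τ₁_ne fun f => by rw [h₁, hφ₁])
  rw [bipartite_iff (edgeInduce_isLink_iff A), bipartite_iff (edgeInduce_isLink_iff Aᶜ)]
  refine ⟨⟨c, hc₁, hc₂, fun f hf => ?_⟩, fun f => h f + c f,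
    fun f => congrArg₂ _ (h₁ f) (hc₁ f), fun f => ?_, fun f hf => ?_⟩
  · have := hc₀ f
    rw [h₀ f hf] at this
    revert this
    generalize h f = p, c f = x, c (G.τ₀ f) = y
    revert p x y
    decide
  · change h (G.τ₀ f) + c (G.τ₀ f) = h f + c f
    have := hc₀ f
    revert this
    generalize h f = p, h (G.τ₀ f) = q, c f = x, c (G.τ₀ f) = y
    revert p q x y
    decide
  · change h (G.τ₂ f) + c (G.τ₂ f) = h f + c f + 1
    rw [h₂ f hf, hc₂]
    ring

end RibbonGraph

/-! ### The theorem on partial duals of plane graphs -/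

theorem theorem3p3 {F E V₀ : Type*} [Finite F] [Finite V₀]
    (G : RibbonGraph F E V₀) (hG : G.IsPlane) (A : Set E) :
    ((G.partialDual A).toGraph.Bipartite ↔
      (∀ C : Graph G.Vertex E, C.IsComponent (G.toGraph.edgeInduce A) → C.Eulerian) ∧
        (∀ C : Graph G.dual.Vertex E, C.IsComponent (G.dual.toGraph.edgeInduce Aᶜ) → C.Eulerian)) ∧
    ((G.partialDual A).toGraph.Eulerian ↔
      (G.toGraph.edgeInduce A).Bipartite ∧ (G.dual.toGraph.edgeInduce Aᶜ).Bipartite) := by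
  have : Finite E := Finite.of_surjective _ G.edge_surj
  have := Fintype.ofFinite F
  have := Fintype.ofFinite E
  rw [Graph.forall_component_eulerian_iff, Graph.forall_component_eulerian_iff,
    Graph.eulerian_iff, and_iff_right (RibbonGraph.partialDual_connected hG.1 A)]
  -- The single-vertex graph is separate: the potential argument needs a flag to exclude isolated
  -- vertices.
  rcases isEmpty_or_nonempty F with hF | hF
  · have hE : IsEmpty E := G.edge_surj.isEmpty
    have hb : ∀ {α : Type _} (H : Graph α E), H.Bipartite := fun H =>
      ⟨fun _ => true, fun e => hE.elim e⟩
    have he : ∀ {α : Type _} (H : Graph α E), H.EvenCuts := fun H c => by simp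
    exact ⟨iff_of_true (hb _) ⟨he _, he _⟩, iff_of_true (he _) ⟨hb _, hb _⟩⟩
  · refine ⟨⟨fun h => ?_, fun h => hG.partialDual_bipartite h.1 h.2⟩,
      hG.bipartite_of_partialDual_evenCuts,
      fun h => RibbonGraph.partialDual_evenCuts h.1 h.2⟩
    obtain ⟨c, h₁, h₀, h₂⟩ := RibbonGraph.partialDual_bipartite_iff.1 h
    exact ⟨RibbonGraph.evenCuts_of_flag_function (RibbonGraph.edgeInduce_isLink_iff A) h₁ h₂,
      RibbonGraph.evenCuts_of_flag_function (RibbonGraph.edgeInduce_isLink_iff Aᶜ) h₁ h₀⟩
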